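/- Let $a$, $d$ and $s$ be integers with $a>1$, $d\ge 1$ and $s\ge 1$. Let $R(n)=b_d n^d+\ldots+b_0$ be a polynomial with integer coefficients and $b_d>0$ such that $R(n)$ is a positive integer for every positive integer $n$. Then there is a constant $c=c(R,a,s)>0$, depending only on $R$, $a$ and $s$, such that \[ N\le \sum_{n=1}^{N}\left(\frac{a^{R(n)}-1}{\varphi\left(a^{R(n)}-1\right)}\right)^{s}\le cN \] for every positive integer $N$, where $\varphi$ denotes Euler's totient function. -/

import Mathlib

/-!
Put `m = a ^ R(n) - 1`. The lower bound holds because `φ(m) ≤ m`. For the upper bound one starts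
from `(m / φ(m)) ^ s ≤ exp (2 s ∑_{p ∣ m} 1 / p)` (`Nat.cast_div_totient_le_exp`) and has to bound
the mean of this exponential over `n ≤ N`.

Expanding the exponential would need the joint divisibility of `m` by several primes. This is avoided
by Jensen's inequality with weights proportional to `1 / (p log p)`. These have a convergent
sum over primes by Chebyshev's bound, and the resulting exponential at the single prime `p` is only
a small power of `p`; so for each `ε > 0`
`exp (t ∑_{p ∣ m} 1 / p) ≤ C (1 + ∑_{p ∣ m} p ^ (ε - 1))`, with `C` independent of `m`
(`Nat.exists_exp_sum_primeFactors_le`). Only divisibility by one prime at a time is left.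

A prime `p` divides `a ^ R(n) - 1` exactly when the order `k` of `a` modulo `p` divides `R(n)`.
If `d + 1` integers in an interval of length `H` satisfy `k ∣ R(n)`, then `k` divides the leading
coefficient times the product of their differences, so `k` is at most a constant times a power of
`H`. Hence an interval of length about `k ^ δ`, for some `δ > 0`, contains at most `d` of
them, and `#{n ≤ N : k ∣ R(n)} ≤ C N k ^ (-δ)`
(`Polynomial.exists_card_filter_dvd_eval_le`). No upper bound on `k` is needed: if there is any such
`n`, then `k ≤ R(n)` is at most a constant times `N ^ d`.

After interchanging the sums over `n` and `p`, what remains is the convergence of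
`∑_p p ^ (ε - 1) k_p ^ (-δ)` for `ε = δ / 8`, where `k_p` is the order of `a` modulo `p`
(`Nat.exists_sum_rpow_mul_orderOf_rpow_le`). When `p ≤ k_p ^ 4` the term is at most
`p ^ (-1 - δ / 8)`; otherwise it is at most `k_p ^ (-3)`, and at most `a k` primes have order `k`
because they all divide `a ^ k - 1`.
-/

/-! ### Jensen's inequality and the totient ratio -/

/-- Jensen's inequality for `exp`, the weight `1 - ∑ w i` missing from a total of `1` being placed
at the point `0`. -/
theorem Real.exp_sum_mul_le_one_add_sum {ι : Type*} (S : Finset ι) (w x : ι → ℝ)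
    (hw : ∀ i ∈ S, 0 ≤ w i) (hw1 : ∑ i ∈ S, w i ≤ 1) :
    Real.exp (∑ i ∈ S, w i * x i) ≤ 1 + ∑ i ∈ S, w i * Real.exp (x i) := by
  have h := convexOn_exp.map_add_sum_le (t := S) (w := w) (p := x) (v := 1 - ∑ i ∈ S, w i) (q := 0)
    hw (by ring) (fun _ _ => Set.mem_univ _) (by linarith) (Set.mem_univ _)
  have h0 : 0 ≤ ∑ i ∈ S, w i := Finset.sum_nonneg hw
  simp only [smul_eq_mul, mul_zero, zero_add, Real.exp_zero, mul_one] at h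
  linarith

theorem Nat.cast_div_totient_le_exp (m : ℕ) (hm : 0 < m) :
    (m : ℝ) / (Nat.totient m : ℝ) ≤ Real.exp (2 * ∑ p ∈ m.primeFactors, (1 : ℝ) / p) := by
  have h1 : (Nat.totient m : ℝ) = m * ∏ p ∈ m.primeFactors, (1 - (p : ℝ)⁻¹) := by
    have := congrArg (fun q : ℚ => (q : ℝ)) (Nat.totient_eq_mul_prod_factors m)
    push_cast at this
    exact this
  have h2 : Real.exp (-(2 * ∑ p ∈ m.primeFactors, (1 : ℝ) / p))
      ≤ ∏ p ∈ m.primeFactors, (1 - (p : ℝ)⁻¹) := by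
    rw [Finset.mul_sum, ← Finset.sum_neg_distrib, Real.exp_sum]
    refine Finset.prod_le_prod (fun _ _ => (Real.exp_pos _).le) fun p hp => ?_
    have hp2 : (2 : ℝ) ≤ p := by exact_mod_cast (Nat.prime_of_mem_primeFactors hp).two_le
    -- `exp (-2x) ≤ 1 / (1 + 2x) ≤ 1 - x` for `0 ≤ x ≤ 1 / 2`.
    have hx0 : (0 : ℝ) < (p : ℝ)⁻¹ := by positivity
    have hx1 : (p : ℝ)⁻¹ ≤ 1 / 2 := by
      rw [one_div]; exact inv_anti₀ (by norm_num) hp2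
    rw [one_div]
    set x := (p : ℝ)⁻¹
    rw [Real.exp_neg]
    have := Real.add_one_le_exp (2 * x)
    rw [inv_le_comm₀ (Real.exp_pos _) (by linarith)]
    refine le_trans ?_ this
    rw [inv_le_iff_one_le_mul₀ (by linarith)]
    nlinarith
  have hm' : (0 : ℝ) < m := by exact_mod_cast hm
  have hφ : (0 : ℝ) < Nat.totient m := by exact_mod_cast Nat.totient_pos.2 hm
  rw [div_le_iff₀ hφ, h1]
  calc (m : ℝ) = m * (Real.exp (2 * ∑ p ∈ m.primeFactors, (1 : ℝ) / p) *
        Real.exp (-(2 * ∑ p ∈ m.primeFactors, (1 : ℝ) / p))) := by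
        rw [← Real.exp_add, add_neg_cancel, Real.exp_zero, mul_one]
    _ ≤ m * (Real.exp (2 * ∑ p ∈ m.primeFactors, (1 : ℝ) / p) *
        ∏ p ∈ m.primeFactors, (1 - (p : ℝ)⁻¹)) := by gcongr
    _ = _ := by ring

/-! ### Chebyshev's bound and the sum of `1 / (p log p)` -/

theorem Nat.card_primeFactors_pow_sub_one_le (a r : ℕ) (ha : 1 < a) (hr : 0 < r) :
    (a ^ r - 1).primeFactors.card ≤ a * r := by
  have hpos : 0 < a ^ r - 1 := Nat.sub_pos_of_lt (Nat.one_lt_pow hr.ne' ha)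
  have h1 : 2 ^ (a ^ r - 1).primeFactors.card ≤ ∏ p ∈ (a ^ r - 1).primeFactors, p :=
    Finset.pow_card_le_prod _ _ _ fun p hp => (Nat.prime_of_mem_primeFactors hp).two_le
  have h2 := Nat.le_of_dvd hpos (Nat.prod_primeFactors_dvd (a ^ r - 1))
  have h3 : a ^ r ≤ 2 ^ (a * r) := by
    rw [pow_mul]; exact Nat.pow_le_pow_left Nat.lt_two_pow_self.le r
  exact (Nat.pow_le_pow_iff_right (a := 2) (by norm_num)).1 (by omega)

/-- Chebyshev's upper bound on a dyadic interval: it contains `O(2 ^ j / j)` primes. The product of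
these primes divides the primorial of `2 ^ (j + 1)`, which is at most `4 ^ 2 ^ (j + 1)`. -/
theorem Nat.mul_card_primes_dyadic_le (j : ℕ) (S : Finset ℕ)
    (hS : ∀ p ∈ S, p.Prime ∧ 2 ^ j ≤ p ∧ p < 2 ^ (j + 1)) :
    j * S.card ≤ 2 ^ (j + 2) := by
  have h1 : (2 ^ j) ^ S.card ≤ ∏ p ∈ S, p :=
    Finset.pow_card_le_prod _ _ _ fun p hp => (hS p hp).2.1
  have h2 : ∏ p ∈ S, p ≤ primorial (2 ^ (j + 1)) := by
    refine Finset.prod_le_prod_of_subset_of_one_le' (fun p hp => ?_) fun p hp _ => ?_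
    · simp only [Finset.mem_filter, Finset.mem_range]
      exact ⟨by have := (hS p hp).2.2; omega, (hS p hp).1⟩
    · simp only [Finset.mem_filter] at hp
      exact hp.2.one_lt.le
  have h3 := primorial_le_four_pow (2 ^ (j + 1))
  have h4 : (4 : ℕ) ^ (2 ^ (j + 1)) = 2 ^ (2 ^ (j + 2)) := by
    rw [show (4 : ℕ) = 2 ^ 2 by norm_num, ← pow_mul]; congr 1; ring
  rw [← pow_mul] at h1
  exact (Nat.pow_le_pow_iff_right (a := 2) (by norm_num)).1 (by omega)

/-- The series `∑ 1 / (p log p)` over primes converges: the primes in `[2 ^ j, 2 ^ (j + 1))`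
contribute at most `4 / j ^ 2`. -/
theorem Nat.summable_prime_one_div_mul_log :
    Summable fun p : ℕ => if p.Prime then (1 : ℝ) / (p * Nat.log 2 p) else 0 := by
  have hs : Summable fun j : ℕ => (4 : ℝ) * (1 / (j : ℝ) ^ 2) :=
    (Real.summable_one_div_nat_pow.2 (by norm_num)).mul_left 4
  refine summable_of_sum_range_le (c := ∑' j : ℕ, (4 : ℝ) * (1 / (j : ℝ) ^ 2))
    (fun p => by split_ifs <;> positivity) fun n => ?_
  rw [← Finset.sum_filter]
  rw [← Finset.sum_fiberwise_of_maps_to (g := Nat.log 2)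
    (t := ((Finset.range n).filter Nat.Prime).image (Nat.log 2))
    (fun x hx => Finset.mem_image_of_mem _ hx)]
  refine le_trans (Finset.sum_le_sum fun j hj => ?_)
    (hs.sum_le_tsum _ fun _ _ => by positivity)
  obtain ⟨q, hq, rfl⟩ := Finset.mem_image.1 hj
  have hq2 := (Finset.mem_filter.1 hq).2.two_le
  have hj1 : 1 ≤ Nat.log 2 q := Nat.log_pos (by norm_num) hq2
  set j := Nat.log 2 q
  set F := ((Finset.range n).filter Nat.Prime).filter (fun x => Nat.log 2 x = j) with hF
  have hmem : ∀ p ∈ F, p.Prime ∧ 2 ^ j ≤ p ∧ p < 2 ^ (j + 1) ∧ Nat.log 2 p = j := by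
    intro p hp
    simp only [hF, Finset.mem_filter] at hp
    obtain ⟨⟨-, hp⟩, hj⟩ := hp
    exact ⟨hp, hj ▸ Nat.pow_log_le_self 2 hp.ne_zero,
      hj ▸ Nat.lt_pow_succ_log_self (by norm_num) p, hj⟩
  have hcard := Nat.mul_card_primes_dyadic_le j F fun p hp =>
    ⟨(hmem p hp).1, (hmem p hp).2.1, (hmem p hp).2.2.1⟩
  have hcard' : (j : ℝ) * F.card ≤ 2 ^ (j + 2) := by exact_mod_cast hcard
  have hj0 : (0 : ℝ) < j := by exact_mod_cast hj1
  calc ∑ p ∈ F, (1 : ℝ) / (p * Nat.log 2 p) ≤ ∑ p ∈ F, (1 : ℝ) / (2 ^ j * j) := by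
        refine Finset.sum_le_sum fun p hp => ?_
        rw [(hmem p hp).2.2.2]
        have : (2 : ℝ) ^ j ≤ p := by exact_mod_cast (hmem p hp).2.1
        gcongr
    _ = F.card / (2 ^ j * j) := by rw [Finset.sum_const, nsmul_eq_mul]; ring
    _ ≤ 4 * (1 / (j : ℝ) ^ 2) := by
        rw [mul_one_div, div_le_div_iff₀ (by positivity) (by positivity)]
        calc (F.card : ℝ) * j ^ 2 = (j * F.card) * j := by ring
          _ ≤ 2 ^ (j + 2) * j := by gcongr
          _ = _ := by ring

/-! ### Values of a polynomial divisible by `k` -/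

/-- If `k` divides `c * f x` at `d + 1` distinct integers `x` at mutual distance at most `H`, where
`d` is the degree of `f`, then `k` divides `c * V * f.leadingCoeff` for some nonzero `V` bounded
by a power of `H`. The `V` constructed is, up to sign, the Vandermonde product of these integers.
The factor `c` is there for the induction on `d`. -/
theorem Polynomial.exists_natCast_dvd_mul_leadingCoeff (k H : ℕ) (d : ℕ) :
    ∀ (f : Polynomial ℤ) (c : ℤ) (S : Finset ℤ), f.natDegree = d → S.card = d + 1 →
      (∀ x ∈ S, ∀ y ∈ S, |x - y| ≤ H) → (∀ x ∈ S, (k : ℤ) ∣ c * f.eval x) →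
      ∃ V : ℤ, V ≠ 0 ∧ |V| ≤ (H : ℤ) ^ (∑ i ∈ Finset.range (d + 1), i) ∧
        (k : ℤ) ∣ c * V * f.leadingCoeff := by
  induction d with
  | zero =>
    intro f c S hf hS _ hk
    obtain ⟨x, hx⟩ := Finset.card_pos.1 (by omega : 0 < S.card)
    refine ⟨1, one_ne_zero, by simp, ?_⟩
    have := hk x hx
    rw [Polynomial.eq_C_of_natDegree_eq_zero hf, eval_C] at this
    rwa [mul_one, Polynomial.leadingCoeff, hf]
  | succ d ih =>
    intro f c S hf hS hH hk
    obtain ⟨x₀, hx₀⟩ := Finset.card_pos.1 (by omega : 0 < S.card)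
    -- `f(x) - f(x₀) = (x - x₀) g(x)`, where `g` has degree `d` and the leading coefficient of `f`.
    set g := f /ₘ (X - C x₀)
    have hfg : ∀ y, f.eval y = (y - x₀) * g.eval y + f.eval x₀ := by
      intro y
      have h := Polynomial.modByMonic_add_div f (X - C x₀)
      rw [Polynomial.modByMonic_X_sub_C_eq_C_eval] at h
      have := congrArg (Polynomial.eval y) h
      simp only [eval_add, eval_C, eval_mul, eval_sub, eval_X] at this
      rw [← this]; ring
    have hgdeg : g.natDegree = d := by
      rw [Polynomial.natDegree_divByMonic f (monic_X_sub_C x₀), hf, natDegree_X_sub_C]; omega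
    have hglc : g.leadingCoeff = f.leadingCoeff :=
      Polynomial.leadingCoeff_divByMonic_X_sub_C f
        (fun h => by
          have := Polynomial.natDegree_eq_of_degree_eq_some (n := 0) (by simpa using h)
          omega) x₀
    -- With `W` absorbed into `c`, the divisibility hypothesis passes from `f` to `g`.
    set W := ∏ y ∈ S.erase x₀, (y - x₀) with hW
    have hcard : (S.erase x₀).card = d + 1 := by rw [Finset.card_erase_of_mem hx₀]; omega
    have hW0 : W ≠ 0 := Finset.prod_ne_zero_iff.2 fun y hy =>
      sub_ne_zero.2 (Finset.ne_of_mem_erase hy)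
    have hWle : |W| ≤ (H : ℤ) ^ (d + 1) := by
      rw [hW, Finset.abs_prod, ← hcard]
      rw [← Finset.prod_const]
      exact Finset.prod_le_prod (fun _ _ => abs_nonneg _)
        fun y hy => hH y (Finset.mem_of_mem_erase hy) x₀ hx₀
    obtain ⟨V, hV0, hVle, hVd⟩ := ih g (c * W) (S.erase x₀) hgdeg hcard
      (fun x hx y hy => hH x (Finset.mem_of_mem_erase hx) y (Finset.mem_of_mem_erase hy))
      (fun y hy => by
        have h1 : (k : ℤ) ∣ c * ((y - x₀) * g.eval y) := by
          have h2 : c * ((y - x₀) * g.eval y) = c * f.eval y - c * f.eval x₀ := by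
            linear_combination -c * hfg y
          rw [h2]
          exact dvd_sub (hk y (Finset.mem_of_mem_erase hy)) (hk x₀ hx₀)
        rw [hW, ← Finset.mul_prod_erase _ _ hy]
        obtain ⟨z, hz⟩ := h1
        exact ⟨z * ∏ y ∈ (S.erase x₀).erase y, (y - x₀), by linear_combination (∏ y ∈ (S.erase x₀).erase y, (y - x₀)) * hz⟩)
    refine ⟨W * V, mul_ne_zero hW0 hV0, ?_, ?_⟩
    · rw [abs_mul, Finset.sum_range_succ, pow_add, mul_comm]
      exact mul_le_mul hVle hWle (abs_nonneg _) (by positivity)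
    · rwa [← hglc, ← mul_assoc]

theorem Polynomial.eval_natCast_le_sum_abs_coeff (R : Polynomial ℤ) (n : ℕ) (hn : 1 ≤ n) :
    R.eval (n : ℤ) ≤ (∑ i ∈ Finset.range (R.natDegree + 1), |R.coeff i|) * (n : ℤ) ^ R.natDegree := by
  rw [Polynomial.eval_eq_sum_range, Finset.sum_mul]
  refine Finset.sum_le_sum fun i hi => ?_
  have hi' : i ≤ R.natDegree := by have := Finset.mem_range.1 hi; omega
  have hn' : (1 : ℤ) ≤ n := by exact_mod_cast hn
  exact mul_le_mul (le_abs_self _) (pow_le_pow_right₀ hn' hi') (by positivity) (abs_nonneg _)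

/-- For `k` large in terms of `H`, every block of `H + 1` consecutive integers contains at most
`R.natDegree` integers `n` with `k ∣ R(n)`. -/
theorem Polynomial.card_filter_dvd_eval_le_of_lt (R : Polynomial ℤ) (hlead : 0 < R.leadingCoeff)
    (k H : ℕ) (hk : R.leadingCoeff * (H : ℤ) ^ (∑ i ∈ Finset.range (R.natDegree + 1), i) < k)
    (N : ℕ) :
    ((Finset.Icc 1 N).filter fun n : ℕ => (k : ℤ) ∣ R.eval (n : ℤ)).card
      ≤ R.natDegree * (N / (H + 1) + 1) := by
  set F := (Finset.Icc 1 N).filter fun n : ℕ => (k : ℤ) ∣ R.eval (n : ℤ) with hF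
  have := Finset.card_le_mul_card_image_of_maps_to (s := F) (f := fun n => n / (H + 1))
    (t := Finset.range (N / (H + 1) + 1)) (fun n hn => by
      simp only [hF, Finset.mem_filter, Finset.mem_Icc] at hn
      have := Nat.div_le_div_right (c := H + 1) hn.1.2
      exact Finset.mem_range.2 (by omega)) R.natDegree (fun b _ => by
      by_contra! hlt
      obtain ⟨S, hS, hScard⟩ := Finset.exists_subset_card_eq (Nat.succ_le_of_lt hlt)
      have hmem : ∀ n ∈ S, (k : ℤ) ∣ R.eval (n : ℤ) ∧ n / (H + 1) = b := by
        intro n hn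
        have := hS hn
        simp only [hF, Finset.mem_filter] at this
        exact ⟨this.1.2, this.2⟩
      obtain ⟨V, hV0, hVle, hVd⟩ := Polynomial.exists_natCast_dvd_mul_leadingCoeff k H R.natDegree R 1
        (S.map Nat.castEmbedding) rfl (by rw [Finset.card_map, hScard])
        (by
          intro x hx y hy
          obtain ⟨n, hn, rfl⟩ := Finset.mem_map.1 hx
          obtain ⟨m, hm, rfl⟩ := Finset.mem_map.1 hy
          have h1 := (hmem n hn).2
          have h2 := (hmem m hm).2
          rw [Nat.div_eq_iff (by omega)] at h1 h2
          simp only [Nat.castEmbedding_apply, abs_le]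
          constructor <;> omega)
        (by
          intro x hx
          obtain ⟨n, hn, rfl⟩ := Finset.mem_map.1 hx
          simpa using (hmem n hn).1)
      have h3 := Int.le_of_dvd (by positivity) ((dvd_abs _ _).2 hVd)
      rw [one_mul, abs_mul, abs_of_pos hlead, mul_comm] at h3
      have h4 := mul_le_mul_of_nonneg_left hVle hlead.le
      omega)
  rwa [Finset.card_range] at this

/-- The bound `#{n ≤ N : k ∣ R(n)} ≤ C N k ^ (-δ)`, uniform in `N` and `k`. -/
theorem Polynomial.exists_card_filter_dvd_eval_le (R : Polynomial ℤ) (hd : 1 ≤ R.natDegree)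
    (hlead : 0 < R.leadingCoeff) (hR : ∀ n : ℕ, 1 ≤ n → 1 ≤ R.eval (n : ℤ)) :
    ∃ δ : ℝ, 0 < δ ∧ δ ≤ 1 ∧ ∃ C : ℝ, 0 < C ∧ ∀ N k : ℕ, 1 ≤ N → 1 ≤ k →
      (((Finset.Icc 1 N).filter fun n : ℕ => (k : ℤ) ∣ R.eval (n : ℤ)).card : ℝ)
        ≤ C * N * (k : ℝ) ^ (-δ) := by
  set D := ∑ i ∈ Finset.range (R.natDegree + 1), i with hD
  have hdD : R.natDegree ≤ D :=
    Finset.single_le_sum (f := fun i : ℕ => i) (fun _ _ => Nat.zero_le _) (Finset.self_mem_range_succ _)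
  have hD1 : 1 ≤ D := hd.trans hdD
  have hD0 : (0 : ℝ) < D := by exact_mod_cast hD1
  -- As `R.natDegree ≤ D`, this `δ` also makes `k ^ δ = O(N)` for every `k = O(N ^ R.natDegree)`.
  set δ : ℝ := (D : ℝ)⁻¹ with hδ
  have hδ0 : 0 < δ := by positivity
  set b : ℝ := (R.leadingCoeff : ℝ) with hbdef
  have hb : 0 < b := by rw [hbdef]; exact_mod_cast hlead
  set B : ℤ := ∑ i ∈ Finset.range (R.natDegree + 1), |R.coeff i|
  have hB0 : (0 : ℝ) ≤ (B : ℝ) := by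
    exact_mod_cast (Finset.sum_nonneg fun _ _ => abs_nonneg _ : 0 ≤ B)
  have hdpos : (0 : ℝ) < R.natDegree := by exact_mod_cast hd
  refine ⟨δ, hδ0, inv_le_one_of_one_le₀ (by exact_mod_cast hD1),
    R.natDegree * (2 * b) ^ δ + R.natDegree * (B : ℝ) ^ δ, by positivity, fun N k hN hk => ?_⟩
  have hk0 : (0 : ℝ) < k := by exact_mod_cast hk
  have hN0 : (1 : ℝ) ≤ N := by exact_mod_cast hN
  rcases Finset.eq_empty_or_nonempty
    ((Finset.Icc 1 N).filter fun n : ℕ => (k : ℤ) ∣ R.eval (n : ℤ)) with he | ⟨n, hn⟩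
  · rw [he, Finset.card_empty, Nat.cast_zero]; positivity
  simp only [Finset.mem_filter, Finset.mem_Icc] at hn
  have hkB : (k : ℝ) ≤ B * (N : ℝ) ^ D := by
    have h1 := Int.le_of_dvd (by have := hR n hn.1.1; omega) hn.2
    have h2 := R.eval_natCast_le_sum_abs_coeff n hn.1.1
    have h3 : (k : ℝ) ≤ B * (n : ℝ) ^ R.natDegree := by exact_mod_cast h1.trans h2
    refine h3.trans (mul_le_mul_of_nonneg_left ?_ hB0)
    exact (pow_le_pow_left₀ (by positivity) (by exact_mod_cast hn.1.2) _).trans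
      (pow_le_pow_right₀ hN0 hdD)
  have hone : 1 ≤ (B : ℝ) ^ δ * N * (k : ℝ) ^ (-δ) := by
    have h1 := Real.rpow_le_rpow hk0.le hkB hδ0.le
    rw [Real.mul_rpow hB0 (by positivity), hδ, Real.pow_rpow_inv_natCast (by positivity) (by omega),
      ← hδ] at h1
    calc (1 : ℝ) = (k : ℝ) ^ δ * (k : ℝ) ^ (-δ) := by
          rw [← Real.rpow_add hk0, add_neg_cancel, Real.rpow_zero]
      _ ≤ _ := by gcongr
  -- The block length `⌊x⌋₊ + 1` is of order `k ^ δ`; it is chosen so that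
  -- `R.leadingCoeff * ⌊x⌋₊ ^ D ≤ k / 2`.
  set x : ℝ := (k / (2 * b)) ^ δ with hx
  have hx0 : 0 < x := by positivity
  have hxD : x ^ D = k / (2 * b) := by
    rw [hx, hδ, Real.rpow_inv_natCast_pow (by positivity) (by omega)]
  have hlt : R.leadingCoeff * ((⌊x⌋₊ : ℕ) : ℤ) ^ D < k := by
    have h1 : b * (⌊x⌋₊ : ℝ) ^ D < k := by
      calc b * (⌊x⌋₊ : ℝ) ^ D ≤ b * x ^ D := by
            gcongr; exact Nat.floor_le hx0.le
        _ = k / 2 := by rw [hxD]; field_simp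
        _ < k := by linarith
    rw [hbdef] at h1
    exact_mod_cast h1
  have hcount := R.card_filter_dvd_eval_le_of_lt hlead k ⌊x⌋₊ hlt N
  have hxinv : x⁻¹ = (2 * b) ^ δ * (k : ℝ) ^ (-δ) := by
    rw [hx, Real.div_rpow hk0.le (by positivity), Real.rpow_neg hk0.le, inv_div, div_eq_mul_inv]
  have hdiv : ((N / (⌊x⌋₊ + 1) : ℕ) : ℝ) ≤ N * x⁻¹ := by
    refine Nat.cast_div_le.trans ?_
    rw [← div_eq_mul_inv]
    have := (Nat.lt_floor_add_one x).le
    push_cast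
    gcongr
  calc _ ≤ ((R.natDegree * (N / (⌊x⌋₊ + 1) + 1) : ℕ) : ℝ) := by exact_mod_cast hcount
    _ = R.natDegree * (((N / (⌊x⌋₊ + 1) : ℕ) : ℝ) + 1) := by push_cast; ring
    _ ≤ R.natDegree * (N * ((2 * b) ^ δ * (k : ℝ) ^ (-δ)) + (B : ℝ) ^ δ * N * (k : ℝ) ^ (-δ)) := by
        rw [← hxinv]; gcongr
    _ = _ := by ring

/-! ### The order of `a` modulo primes -/

theorem Nat.dvd_pow_sub_one_iff_orderOf_dvd (a r p : ℕ) (ha : 1 < a) :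
    p ∣ a ^ r - 1 ↔ orderOf (a : ZMod p) ∣ r := by
  rw [orderOf_dvd_iff_pow_eq_one, ← CharP.cast_eq_zero_iff (ZMod p) p,
    Nat.cast_sub (Nat.one_le_pow _ _ (by omega)), sub_eq_zero]
  push_cast; rfl

/-- The sum of `p ^ (δ / 8 - 1) * k_p ^ (-δ)` over the primes `p` not dividing `a` is finite, where
`k_p` is the order of `a` modulo `p`. The condition `1 ≤ orderOf` expresses `p ∤ a`, the junk value
`orderOf = 0` being taken when `p ∣ a`. -/
theorem Nat.exists_sum_rpow_mul_orderOf_rpow_le (a : ℕ) (ha : 1 < a) (δ : ℝ) (hδ : 0 < δ)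
    (hδ1 : δ ≤ 1) :
    ∃ K : ℝ, 0 < K ∧ ∀ U : Finset ℕ, (∀ p ∈ U, p.Prime ∧ 1 ≤ orderOf (a : ZMod p)) →
      ∑ p ∈ U, (p : ℝ) ^ (δ / 8 - 1) * (orderOf (a : ZMod p) : ℝ) ^ (-δ) ≤ K := by
  have hs1 : Summable fun n : ℕ => (n : ℝ) ^ (-1 - δ / 8) := Real.summable_nat_rpow.2 (by linarith)
  have hs2 : Summable fun k : ℕ => (a : ℝ) * (1 / (k : ℝ) ^ 2) :=
    (Real.summable_one_div_nat_pow.2 (by norm_num)).mul_left _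
  refine ⟨(∑' n : ℕ, (n : ℝ) ^ (-1 - δ / 8)) + (∑' k : ℕ, (a : ℝ) * (1 / (k : ℝ) ^ 2)) + 1, ?_,
    fun U hU => ?_⟩
  · have : 0 ≤ ∑' n : ℕ, (n : ℝ) ^ (-1 - δ / 8) := tsum_nonneg fun n => by positivity
    have : 0 ≤ ∑' k : ℕ, (a : ℝ) * (1 / (k : ℝ) ^ 2) := tsum_nonneg fun k => by positivity
    linarith
  have hterm : ∀ p ∈ U, (p : ℝ) ^ (δ / 8 - 1) * (orderOf (a : ZMod p) : ℝ) ^ (-δ)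
      ≤ (p : ℝ) ^ (-1 - δ / 8) + 1 / (orderOf (a : ZMod p) : ℝ) ^ 3 := by
    intro p hp
    obtain ⟨hp1, hk⟩ := hU p hp
    set k := orderOf (a : ZMod p)
    have hk1 : (1 : ℝ) ≤ k := by exact_mod_cast hk
    have hp0 : (0 : ℝ) < p := by exact_mod_cast hp1.pos
    rcases le_total (p : ℝ) ((k : ℝ) ^ 4) with h | h
    · have h1 : (k : ℝ) ^ (-δ) ≤ (p : ℝ) ^ (-(δ / 4)) := by
        have h2 := Real.rpow_le_rpow_of_nonpos hp0 h (by linarith : -(δ / 4) ≤ 0)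
        rw [← Real.rpow_natCast, ← Real.rpow_mul (by positivity)] at h2
        convert h2 using 2; push_cast; ring
      have h3 : (p : ℝ) ^ (δ / 8 - 1) * (k : ℝ) ^ (-δ) ≤ (p : ℝ) ^ (-1 - δ / 8) := by
        calc _ ≤ (p : ℝ) ^ (δ / 8 - 1) * (p : ℝ) ^ (-(δ / 4)) := by gcongr
          _ = _ := by rw [← Real.rpow_add hp0]; congr 1; ring
      have : 0 ≤ 1 / (k : ℝ) ^ 3 := by positivity
      linarith
    · have h1 : (k : ℝ) ^ (-δ) ≤ 1 := Real.rpow_le_one_of_one_le_of_nonpos hk1 (by linarith)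
      have h2 : (p : ℝ) ^ (δ / 8 - 1) ≤ 1 / (k : ℝ) ^ 3 := by
        calc (p : ℝ) ^ (δ / 8 - 1) ≤ ((k : ℝ) ^ 4) ^ (δ / 8 - 1) :=
              Real.rpow_le_rpow_of_nonpos (by positivity) h (by linarith)
          _ = (k : ℝ) ^ (4 * (δ / 8 - 1)) := by
              rw [← Real.rpow_natCast, ← Real.rpow_mul (by positivity)]; norm_num
          _ ≤ (k : ℝ) ^ (-(3 : ℕ) : ℝ) := by
              apply Real.rpow_le_rpow_of_exponent_le hk1; push_cast; linarith
          _ = 1 / (k : ℝ) ^ 3 := by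
              rw [Real.rpow_neg (by positivity), Real.rpow_natCast, one_div]
      have h3 : (p : ℝ) ^ (δ / 8 - 1) * (k : ℝ) ^ (-δ) ≤ 1 / (k : ℝ) ^ 3 * 1 := by gcongr
      have : 0 ≤ (p : ℝ) ^ (-1 - δ / 8) := by positivity
      linarith
  -- The primes of order `k` divide `a ^ k - 1`, so there are at most `a * k` of them.
  have hord : ∑ p ∈ U, 1 / (orderOf (a : ZMod p) : ℝ) ^ 3 ≤ ∑' k : ℕ, (a : ℝ) * (1 / (k : ℝ) ^ 2) := by
    rw [← Finset.sum_fiberwise_of_maps_to (g := fun p : ℕ => orderOf (a : ZMod p))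
      (t := U.image fun p : ℕ => orderOf (a : ZMod p)) (fun x hx => Finset.mem_image_of_mem _ hx)]
    refine le_trans (Finset.sum_le_sum fun k hk => ?_)
      (hs2.sum_le_tsum _ fun _ _ => by positivity)
    have hk1 : 1 ≤ k := by
      obtain ⟨q, hq, rfl⟩ := Finset.mem_image.1 hk
      exact (hU q hq).2
    have hk0 : (0 : ℝ) < k := by exact_mod_cast hk1
    have hcard : (U.filter fun p : ℕ => orderOf (a : ZMod p) = k).card ≤ a * k := by
      refine le_trans (Finset.card_le_card fun p hp => ?_)
        (Nat.card_primeFactors_pow_sub_one_le a k ha hk1)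
      obtain ⟨hpU, hpk⟩ := Finset.mem_filter.1 hp
      rw [Nat.mem_primeFactors]
      exact ⟨(hU p hpU).1, (Nat.dvd_pow_sub_one_iff_orderOf_dvd a k p ha).2 (hpk ▸ dvd_rfl),
        (Nat.sub_pos_of_lt (Nat.one_lt_pow (by omega) ha)).ne'⟩
    have hcard' : ((U.filter fun p : ℕ => orderOf (a : ZMod p) = k).card : ℝ) ≤ a * k := by
      exact_mod_cast hcard
    calc _ = ∑ p ∈ U.filter fun p : ℕ => orderOf (a : ZMod p) = k, 1 / (k : ℝ) ^ 3 :=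
          Finset.sum_congr rfl fun p hp => by rw [(Finset.mem_filter.1 hp).2]
      _ = (U.filter fun p : ℕ => orderOf (a : ZMod p) = k).card * (1 / (k : ℝ) ^ 3) := by
          rw [Finset.sum_const, nsmul_eq_mul]
      _ ≤ (a * k) * (1 / (k : ℝ) ^ 3) := by gcongr
      _ = _ := by field_simp
  have hp := hs1.sum_le_tsum U fun _ _ => by positivity
  have := Finset.sum_le_sum hterm
  rw [Finset.sum_add_distrib] at this
  linarith

/-! ### The exponential of `∑ 1 / p` over prime factors -/

/-- Linearization of `exp (t ∑_{p ∣ m} 1 / p)`, by Jensen's inequality with weights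
`η / (p log₂ p)`. All primes outside a fixed finite set `A` have total weight at most `1`; those in
`A` contribute a bounded factor. -/
theorem Nat.exists_exp_sum_primeFactors_le (t ε : ℝ) (ht : 0 < t) (hε : 0 < ε) :
    ∃ C : ℝ, 0 < C ∧ ∀ m : ℕ, Real.exp (t * ∑ p ∈ m.primeFactors, (1 : ℝ) / p)
      ≤ C * (1 + ∑ p ∈ m.primeFactors, (p : ℝ) ^ (ε - 1)) := by
  have hlog2 : 0 < Real.log 2 := Real.log_pos (by norm_num)
  -- This `η` turns `exp (t * log₂ p / η)` into at most `p ^ ε`.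
  set η : ℝ := t / (ε * Real.log 2) with hη
  have hη0 : 0 < η := by positivity
  set w : ℕ → ℝ := fun p => η * if p.Prime then (1 : ℝ) / (p * Nat.log 2 p) else 0 with hw
  have hw0 : ∀ p, 0 ≤ w p := fun p => by
    simp only [hw]; split_ifs <;> positivity
  have hws : Summable w := Nat.summable_prime_one_div_mul_log.mul_left η
  obtain ⟨A, hA⟩ := (summable_iff_vanishing_norm.1 hws) 1 one_pos
  set E : ℝ := Real.exp (t * ∑ p ∈ A, (1 : ℝ) / p)
  refine ⟨E * (1 + η), by positivity, fun m => ?_⟩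
  have hsplit : ∑ p ∈ m.primeFactors, (1 : ℝ) / p
      ≤ ∑ p ∈ A, (1 : ℝ) / p + ∑ p ∈ m.primeFactors \ A, (1 : ℝ) / p := by
    rw [← Finset.sum_inter_add_sum_sdiff m.primeFactors A]
    gcongr
    exact Finset.inter_subset_right
  set S := m.primeFactors \ A
  have hS : ∀ p ∈ S, p.Prime := fun p hp => Nat.prime_of_mem_primeFactors (Finset.mem_sdiff.1 hp).1
  have hS1 : ∑ p ∈ S, w p ≤ 1 :=
    (le_abs_self _).trans (hA S Finset.sdiff_disjoint).le
  have hwp : ∀ p ∈ S, 1 ≤ Nat.log 2 p ∧ w p = η / (p * Nat.log 2 p) := fun p hp =>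
    ⟨Nat.log_pos (by norm_num) (hS p hp).two_le, by simp only [hw, if_pos (hS p hp)]; ring⟩
  have hJ := Real.exp_sum_mul_le_one_add_sum S w (fun p => t * Nat.log 2 p / η)
    (fun p _ => hw0 p) hS1
  have hleft : ∑ p ∈ S, w p * (t * Nat.log 2 p / η) = t * ∑ p ∈ S, (1 : ℝ) / p := by
    rw [Finset.mul_sum]
    refine Finset.sum_congr rfl fun p hp => ?_
    obtain ⟨h1, h2⟩ := hwp p hp
    have hj : (0 : ℝ) < Nat.log 2 p := by exact_mod_cast h1
    have hp0 : (0 : ℝ) < p := by exact_mod_cast (hS p hp).pos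
    rw [h2]; field_simp
  have hright : ∑ p ∈ S, w p * Real.exp (t * Nat.log 2 p / η)
      ≤ η * ∑ p ∈ m.primeFactors, (p : ℝ) ^ (ε - 1) := by
    rw [Finset.mul_sum]
    refine (Finset.sum_le_sum fun p hp => ?_).trans
      (Finset.sum_le_sum_of_subset_of_nonneg (f := fun p : ℕ => η * (p : ℝ) ^ (ε - 1))
        Finset.sdiff_subset fun _ _ _ => by positivity)
    obtain ⟨h1, h2⟩ := hwp p hp
    have hj : (1 : ℝ) ≤ Nat.log 2 p := by exact_mod_cast h1
    have hp0 : (0 : ℝ) < p := by exact_mod_cast (hS p hp).pos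
    have h3 : w p ≤ η * (p : ℝ) ^ (-1 : ℝ) := by
      rw [h2, Real.rpow_neg_one, ← div_eq_mul_inv]
      gcongr
      nlinarith
    have h4 : Real.exp (t * Nat.log 2 p / η) ≤ (p : ℝ) ^ ε := by
      rw [Real.rpow_def_of_pos hp0]
      refine Real.exp_le_exp.2 ?_
      have h5 : (Nat.log 2 p : ℝ) * Real.log 2 ≤ Real.log p := by
        rw [← Real.log_pow]
        refine Real.log_le_log (by positivity) ?_
        exact_mod_cast Nat.pow_log_le_self 2 (hS p hp).ne_zero
      calc t * Nat.log 2 p / η = (Nat.log 2 p * Real.log 2) * ε := by rw [hη]; field_simp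
        _ ≤ _ := by gcongr
    calc w p * Real.exp (t * Nat.log 2 p / η) ≤ (η * (p : ℝ) ^ (-1 : ℝ)) * (p : ℝ) ^ ε := by
          gcongr
      _ = η * (p : ℝ) ^ (ε - 1) := by
          rw [mul_assoc, ← Real.rpow_add hp0]; congr 2; ring
  rw [hleft] at hJ
  have hpos : 0 ≤ ∑ p ∈ m.primeFactors, (p : ℝ) ^ (ε - 1) :=
    Finset.sum_nonneg fun _ _ => by positivity
  calc Real.exp (t * ∑ p ∈ m.primeFactors, (1 : ℝ) / p)
      ≤ Real.exp (t * (∑ p ∈ A, (1 : ℝ) / p + ∑ p ∈ S, (1 : ℝ) / p)) := by gcongr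
    _ = E * Real.exp (t * ∑ p ∈ S, (1 : ℝ) / p) := by rw [mul_add, Real.exp_add]
    _ ≤ E * (1 + η * ∑ p ∈ m.primeFactors, (p : ℝ) ^ (ε - 1)) := by
        gcongr; linarith
    _ ≤ E * ((1 + η) * (1 + ∑ p ∈ m.primeFactors, (p : ℝ) ^ (ε - 1))) := by
        gcongr; nlinarith
    _ = _ := by ring

/-! ### The mean value -/

theorem theorem1 (a d s : ℕ) (ha : 1 < a) (hd : 1 ≤ d) (hs : 1 ≤ s)
    (R : Polynomial ℤ) (hdeg : R.natDegree = d) (hlead : 0 < R.leadingCoeff)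
    (hR : ∀ n : ℕ, 1 ≤ n → 1 ≤ R.eval (n : ℤ)) :
    ∃ c : ℝ, 0 < c ∧ ∀ N : ℕ, 1 ≤ N →
      (N : ℝ) ≤ ∑ n ∈ Finset.Icc 1 N,
          (((a ^ (R.eval (n : ℤ)).toNat - 1 : ℕ) : ℝ) /
            (Nat.totient (a ^ (R.eval (n : ℤ)).toNat - 1) : ℝ)) ^ s ∧
        ∑ n ∈ Finset.Icc 1 N,
          (((a ^ (R.eval (n : ℤ)).toNat - 1 : ℕ) : ℝ) /
            (Nat.totient (a ^ (R.eval (n : ℤ)).toNat - 1) : ℝ)) ^ s ≤ c * (N : ℝ) := by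
  obtain ⟨δ, hδ0, hδ1, C₁, hC₁, hcount⟩ := R.exists_card_filter_dvd_eval_le (hdeg ▸ hd) hlead hR
  obtain ⟨K, hK, hsum⟩ := Nat.exists_sum_rpow_mul_orderOf_rpow_le a ha δ hδ0 hδ1
  have hs0 : (0 : ℝ) < s := by exact_mod_cast hs
  obtain ⟨C₂, hC₂, hexp⟩ :=
    Nat.exists_exp_sum_primeFactors_le (s * 2) (δ / 8) (by positivity) (by positivity)
  set m : ℕ → ℕ := fun n => a ^ (R.eval (n : ℤ)).toNat - 1 with hm
  have hr : ∀ n : ℕ, 1 ≤ n → 0 < (R.eval (n : ℤ)).toNat := fun n hn => by have := hR n hn; omega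
  have hm0 : ∀ n, 1 ≤ n → 0 < m n := fun n hn =>
    Nat.sub_pos_of_lt (Nat.one_lt_pow (hr n hn).ne' ha)
  have hdvd : ∀ n p : ℕ, 1 ≤ n → (p ∣ m n ↔ (orderOf (a : ZMod p) : ℤ) ∣ R.eval (n : ℤ)) := by
    intro n p hn
    have h := hR n hn
    rw [hm, Nat.dvd_pow_sub_one_iff_orderOf_dvd a _ p ha, ← Int.natCast_dvd_natCast,
      Int.toNat_of_nonneg (by omega)]
  refine ⟨C₂ * (1 + C₁ * K), by positivity, fun N hN => ⟨?_, ?_⟩⟩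
  · calc (N : ℝ) = ∑ n ∈ Finset.Icc 1 N, (1 : ℝ) := by simp
      _ ≤ _ := Finset.sum_le_sum fun n hn => by
        have h := hm0 n (Finset.mem_Icc.1 hn).1
        refine one_le_pow₀ ((one_le_div (by exact_mod_cast Nat.totient_pos.2 h)).2 ?_)
        exact_mod_cast Nat.totient_le (m n)
  · have hpt : ∀ n ∈ Finset.Icc 1 N, ((m n : ℝ) / (Nat.totient (m n) : ℝ)) ^ s
        ≤ C₂ * (1 + ∑ p ∈ (m n).primeFactors, (p : ℝ) ^ (δ / 8 - 1)) := by
      intro n hn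
      refine le_trans ?_ (hexp (m n))
      rw [mul_assoc, Real.exp_nat_mul]
      gcongr
      exact Nat.cast_div_totient_le_exp (m n) (hm0 n (Finset.mem_Icc.1 hn).1)
    -- Every prime in `U` divides some `a ^ R(n) - 1`, hence is coprime to `a`.
    set U := (Finset.Icc 1 N).biUnion fun n => (m n).primeFactors with hUdef
    have hU : ∀ p ∈ U, p.Prime ∧ 1 ≤ orderOf (a : ZMod p) := by
      intro p hp
      obtain ⟨n, hn, hpn⟩ := Finset.mem_biUnion.1 hp
      have h1 := (Finset.mem_Icc.1 hn).1
      refine ⟨Nat.prime_of_mem_primeFactors hpn, Nat.pos_of_ne_zero fun h0 => ?_⟩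
      have h2 := (hdvd n p h1).1 (Nat.dvd_of_mem_primeFactors hpn)
      have h3 := hR n h1
      rw [h0, Nat.cast_zero, zero_dvd_iff] at h2
      omega
    have hswap : ∑ n ∈ Finset.Icc 1 N, ∑ p ∈ (m n).primeFactors, (p : ℝ) ^ (δ / 8 - 1)
        ≤ C₁ * N * K := by
      calc _ = ∑ p ∈ U, ∑ n ∈ (Finset.Icc 1 N).filter
            (fun n : ℕ => (orderOf (a : ZMod p) : ℤ) ∣ R.eval (n : ℤ)), (p : ℝ) ^ (δ / 8 - 1) := by
            refine Finset.sum_comm' fun n p => ?_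
            simp only [Finset.mem_filter, hUdef, Finset.mem_biUnion]
            constructor
            · rintro ⟨hn, hp⟩
              exact ⟨⟨hn, (hdvd n p (Finset.mem_Icc.1 hn).1).1 (Nat.dvd_of_mem_primeFactors hp)⟩,
                n, hn, hp⟩
            · rintro ⟨⟨hn, hd⟩, n', -, hp⟩
              have h1 := (Finset.mem_Icc.1 hn).1
              exact ⟨hn, Nat.mem_primeFactors.2 ⟨Nat.prime_of_mem_primeFactors hp,
                (hdvd n p h1).2 hd, (hm0 n h1).ne'⟩⟩
        _ ≤ ∑ p ∈ U, C₁ * N * ((p : ℝ) ^ (δ / 8 - 1) * (orderOf (a : ZMod p) : ℝ) ^ (-δ)) := by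
            refine Finset.sum_le_sum fun p hp => ?_
            rw [Finset.sum_const, nsmul_eq_mul]
            calc _ ≤ (C₁ * N * (orderOf (a : ZMod p) : ℝ) ^ (-δ)) * (p : ℝ) ^ (δ / 8 - 1) := by
                  gcongr
                  exact hcount N _ hN (hU p hp).2
              _ = _ := by ring
        _ ≤ C₁ * N * K := by
            rw [← Finset.mul_sum]
            gcongr
            exact hsum U hU
    calc _ ≤ ∑ n ∈ Finset.Icc 1 N, C₂ * (1 + ∑ p ∈ (m n).primeFactors, (p : ℝ) ^ (δ / 8 - 1)) :=
          Finset.sum_le_sum hpt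
      _ = C₂ * (N + ∑ n ∈ Finset.Icc 1 N, ∑ p ∈ (m n).primeFactors, (p : ℝ) ^ (δ / 8 - 1)) := by
          rw [← Finset.mul_sum, Finset.sum_add_distrib]; simp
      _ ≤ C₂ * (N + C₁ * N * K) := by gcongr
      _ = _ := by ring
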